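/- Consider the two-user weak Gaussian interference channel $Y_1=X_1+\sqrt{a}\,X_2+Z_1$, $Y_2=\sqrt{b}\,X_1+X_2+Z_2$ with $0<a<1$, $0<b<1$, Gaussian noises $Z_1,Z_2$ of power $1$, power budgets $P_1,P_2\ge 0$ and a weight $\mu>0$. Each user $i$ sends $X_i=U_i+V_i$, where the public part $U_i$ (decoded at both receivers) is a superposition of finitely many independent Gaussian layers of total power $P_i^{(public)}\ge 0$, the private part $V_i$ (decoded at receiver $i$ only) is an independent Gaussian code-book of power $P_i^{(private)}\ge 0$, and $P_i^{(public)}+P_i^{(private)}\le P_i$. Write $C(x)=\tfrac12\log_2(1+x)$. The following rates are allowed. (i) Public layers: let $q_\ell$ be the power of layer $\ell$, let $g_{1,\ell}=1$, $g_{2,\ell}=b$ if $\ell$ belongs to user 1, and $g_{1,\ell}=a$, $g_{2,\ell}=1$ if $\ell$ belongs to user 2, and put $\sigma_1^2=P_1^{(private)}+aP_2^{(private)}+1$, $\sigma_2^2=bP_1^{(private)}+P_2^{(private)}+1$. The rates $r_\ell\ge 0$ lie in the intersection of the two multiple access regions formed at the receivers with the private messages treated as noise, i.e. $\sum_{\ell\in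 S}r_\ell\le C\big(\sum_{\ell\in S}g_{k,\ell}\,q_\ell/\sigma_k^2\big)$ for $k=1,2$ and every set $S$ of public layers of the two users. (ii) Private messages, decoded after the public ones are removed: $0\le R_{V_1}\le C\big(P_1^{(private)}/(aP_2^{(private)}+1)\big)$ and $0\le R_{V_2}\le C\big(P_2^{(private)}/(bP_1^{(private)}+1)\big)$. Let $R_i$ be the sum of $R_{V_i}$ and the rates of the public layers of user $i$. A power allocation $(P_1^{(public)},P_1^{(private)},P_2^{(public)},P_2^{(private)})$ is called optimum if some rates that it allows attain the maximum of $R_{ws}=R_1+\mu R_2$ over all allocations within the budgets, all layerings and all allowed rates. Then an optimum power allocation exists, and every optimum power allocation satisfies $P_1^{(public)}+P_1^{(private)}=P_1$ and $P_2^{(public)}+P_2^{(private)}=P_2$; that is, the power budgets are completely utilized. -/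

import Mathlib

namespace GIC

/-- The rate (in bits per real dimension) of a Gaussian code-book received with signal-to-noise
ratio `snr`: the capacity of the corresponding AWGN channel. -/
noncomputable def rate (snr : ℝ) : ℝ := (1 / 2) * Real.logb 2 (1 + snr)

/-- The capacity region of the Gaussian multiple access channel with independent inputs indexed
by `ι`, with received powers `p` and noise power `s`: the rate vectors that can be jointly
decoded. It contains all points reached by successive decoding, in any order. -/
def macRegion {ι : Type*} (p : ι → ℝ) (s : ℝ) : Set (ι → ℝ) :=
  {r | (∀ i, 0 ≤ r i) ∧
    ∀ S : Finset ι, ∑ i ∈ S, r i ≤ rate ((∑ i ∈ S, p i) / s)}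

/-- The powers that the two users give to their public and to their private messages. -/
structure PowerAllocation where
  pub₁ : ℝ
  priv₁ : ℝ
  pub₂ : ℝ
  priv₂ : ℝ

/-- The powers are nonnegative and respect the two power budgets. -/
def PowerAllocation.Feasible (A : PowerAllocation) (P₁ P₂ : ℝ) : Prop :=
  0 ≤ A.pub₁ ∧ 0 ≤ A.priv₁ ∧ 0 ≤ A.pub₂ ∧ 0 ≤ A.priv₂ ∧
    A.pub₁ + A.priv₁ ≤ P₁ ∧ A.pub₂ + A.priv₂ ≤ P₂

/-- `(R₁, R₂)` is a pair of rates that the allocation `A` allows on the channel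
`Y₁ = X₁ + √a X₂ + Z₁`, `Y₂ = √b X₁ + X₂ + Z₂` with unit-power Gaussian noises, where
`Xᵢ = Uᵢ + Vᵢ` and `Uᵢ` (public) and `Vᵢ` (private) are Gaussian and independent.

* User `i` splits its public power into `nᵢ` public layers of powers `qᵢ`. With the private
  messages treated as noise, the public layers of both users form a multiple access channel at
  each receiver; as all of them are decoded at both receivers, their rates `r` lie in the
  intersection of the two capacity regions.
* After the public layers are decoded and removed, each receiver decodes its own private message,
  of rate `v₁` resp. `v₂`, treating the other private message as noise. -/
def IsAchievable (a b : ℝ) (A : PowerAllocation) (R₁ R₂ : ℝ) : Prop :=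
  ∃ (n₁ n₂ : ℕ) (q₁ : Fin n₁ → ℝ) (q₂ : Fin n₂ → ℝ) (r : Fin n₁ ⊕ Fin n₂ → ℝ) (v₁ v₂ : ℝ),
    (∀ i, 0 ≤ q₁ i) ∧ (∀ j, 0 ≤ q₂ j) ∧
    ∑ i, q₁ i = A.pub₁ ∧ ∑ j, q₂ j = A.pub₂ ∧
    r ∈ macRegion (Sum.elim q₁ (fun j => a * q₂ j)) (A.priv₁ + a * A.priv₂ + 1) ∧
    r ∈ macRegion (Sum.elim (fun i => b * q₁ i) q₂) (b * A.priv₁ + A.priv₂ + 1) ∧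
    0 ≤ v₁ ∧ v₁ ≤ rate (A.priv₁ / (a * A.priv₂ + 1)) ∧
    0 ≤ v₂ ∧ v₂ ≤ rate (A.priv₂ / (b * A.priv₁ + 1)) ∧
    R₁ = ∑ i, r (Sum.inl i) + v₁ ∧ R₂ = ∑ j, r (Sum.inr j) + v₂

/-- `A` is an optimum power allocation for the budgets `P₁`, `P₂` and the weight `μ`: it is
feasible, and it allows rates whose weighted sum `R₁ + μ R₂` is the largest one among all rates
that feasible allocations allow. -/
def IsOptimal (a b P₁ P₂ μ : ℝ) (A : PowerAllocation) : Prop :=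
  A.Feasible P₁ P₂ ∧
    ∃ R₁ R₂ : ℝ, IsAchievable a b A R₁ R₂ ∧
      ∀ (A' : PowerAllocation) (R₁' R₂' : ℝ), A'.Feasible P₁ P₂ → IsAchievable a b A' R₁' R₂' →
        R₁' + μ * R₂' ≤ R₁ + μ * R₂

end GIC

namespace GIC

/-! Public powers never appear as noise: public layers are decoded jointly and removed before the
private ones. Hence giving a user's unspent power to its public part leaves the private constraints
intact and strictly relaxes every constraint on its public rate (`SingleLayer.exists_increase₁`,
`SingleLayer.exists_increase₂`), so an optimum leaves nothing unspent. For existence, layering is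
irrelevant to the total rates (`isAchievable_iff`), so the problem is to maximize a linear
functional over a nonempty compact subset of `Fin 8 → ℝ`. -/

lemma rate_le_rate {x y : ℝ} (hx : 0 ≤ x) (hxy : x ≤ y) : rate x ≤ rate y := by
  have := Real.logb_le_logb_of_le (b := 2) (by norm_num) (show 0 < 1 + x by linarith)
    (show 1 + x ≤ 1 + y by linarith)
  unfold rate
  linarith

lemma rate_lt_rate {x y : ℝ} (hx : 0 ≤ x) (hxy : x < y) : rate x < rate y := by
  have := Real.logb_lt_logb (b := 2) (by norm_num) (show 0 < 1 + x by linarith)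
    (show 1 + x < 1 + y by linarith)
  unfold rate
  linarith

lemma rate_zero : rate 0 = 0 := by simp [rate]

lemma rate_div_le_rate {p s P : ℝ} (hp : 0 ≤ p) (hs : 1 ≤ s) (hP : p ≤ P) :
    rate (p / s) ≤ rate P :=
  rate_le_rate (by positivity) ((div_le_self hp hs).trans hP)

lemma rate_div_lt_rate_div {p p' s : ℝ} (hp : 0 ≤ p) (hs : 0 < s) (h : p < p') :
    rate (p / s) < rate (p' / s) :=
  rate_lt_rate (by positivity) (by gcongr)

lemma continuousOn_rate_div {X : Type*} [TopologicalSpace X] {s : Set X} {f g : X → ℝ}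
    (hf : Continuous f) (hg : Continuous g) (hf0 : ∀ x ∈ s, 0 ≤ f x) (hg0 : ∀ x ∈ s, 0 < g x) :
    ContinuousOn (fun x => rate (f x / g x)) s := by
  have hdiv : ContinuousOn (fun x => f x / g x) s :=
    hf.continuousOn.div hg.continuousOn fun x hx => (hg0 x hx).ne'
  have hlog : ContinuousOn (fun x => Real.log (1 + f x / g x)) s :=
    (continuousOn_const.add hdiv).log fun x hx => by
      have := div_nonneg (hf0 x hx) (hg0 x hx).le
      exact (show 0 < 1 + f x / g x by linarith).ne'
  exact continuousOn_const.mul (hlog.div_const _)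

/-- The rates `x`, `y` of the public messages and `v₁`, `v₂` of the private messages are allowed
by `A` when each user has a single public layer. -/
def SingleLayer (a b : ℝ) (A : PowerAllocation) (x y v₁ v₂ : ℝ) : Prop :=
  0 ≤ x ∧ 0 ≤ y ∧
    x ≤ rate (A.pub₁ / (A.priv₁ + a * A.priv₂ + 1)) ∧
    y ≤ rate ((a * A.pub₂) / (A.priv₁ + a * A.priv₂ + 1)) ∧
    x + y ≤ rate ((A.pub₁ + a * A.pub₂) / (A.priv₁ + a * A.priv₂ + 1)) ∧
    x ≤ rate ((b * A.pub₁) / (b * A.priv₁ + A.priv₂ + 1)) ∧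
    y ≤ rate (A.pub₂ / (b * A.priv₁ + A.priv₂ + 1)) ∧
    x + y ≤ rate ((b * A.pub₁ + A.pub₂) / (b * A.priv₁ + A.priv₂ + 1)) ∧
    0 ≤ v₁ ∧ v₁ ≤ rate (A.priv₁ / (a * A.priv₂ + 1)) ∧
    0 ≤ v₂ ∧ v₂ ≤ rate (A.priv₂ / (b * A.priv₁ + 1))

lemma sum_mem_of_mem_macRegion {n₁ n₂ : ℕ} {p₁ : Fin n₁ → ℝ} {p₂ : Fin n₂ → ℝ} {s : ℝ}
    {r : Fin n₁ ⊕ Fin n₂ → ℝ} (h : r ∈ macRegion (Sum.elim p₁ p₂) s) :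
    ∑ i, r (Sum.inl i) ≤ rate ((∑ i, p₁ i) / s) ∧
    ∑ j, r (Sum.inr j) ≤ rate ((∑ j, p₂ j) / s) ∧
    ∑ i, r (Sum.inl i) + ∑ j, r (Sum.inr j) ≤ rate ((∑ i, p₁ i + ∑ j, p₂ j) / s) := by
  refine ⟨?_, ?_, ?_⟩
  · simpa using h.2 (Finset.univ.map Function.Embedding.inl)
  · simpa using h.2 (Finset.univ.map Function.Embedding.inr)
  · simpa using h.2 Finset.univ

lemma mem_macRegion_of_single {p₁ p₂ s x y : ℝ} (hx : 0 ≤ x) (hy : 0 ≤ y)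
    (h₁ : x ≤ rate (p₁ / s)) (h₂ : y ≤ rate (p₂ / s)) (h₁₂ : x + y ≤ rate ((p₁ + p₂) / s)) :
    (Sum.elim (fun _ => x) (fun _ => y) : Fin 1 ⊕ Fin 1 → ℝ) ∈
      macRegion (Sum.elim (fun _ => p₁) (fun _ => p₂)) s := by
  refine ⟨by rintro (i | i) <;> simpa, fun S => ?_⟩
  have hS : ∀ S : Finset (Fin 1 ⊕ Fin 1),
      S = ∅ ∨ S = {Sum.inl 0} ∨ S = {Sum.inr 0} ∨ S = Finset.univ := by decide
  rcases hS S with rfl | rfl | rfl | rfl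
  · simp [rate_zero]
  · simpa using h₁
  · simpa using h₂
  · simpa using h₁₂

/-- Only the total public rate of each user counts, and the constraints for the layers of user 1,
those of user 2 and all layers together are exactly the single-layer ones. Conversely, one layer per
user is a legitimate layering. -/
lemma isAchievable_iff {a b : ℝ} {A : PowerAllocation} {R₁ R₂ : ℝ} (h₁ : 0 ≤ A.pub₁)
    (h₂ : 0 ≤ A.pub₂) :
    IsAchievable a b A R₁ R₂ ↔
      ∃ x y v₁ v₂, SingleLayer a b A x y v₁ v₂ ∧ R₁ = x + v₁ ∧ R₂ = y + v₂ := by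
  constructor
  · rintro ⟨n₁, n₂, q₁, q₂, r, v₁, v₂, -, -, hq₁, hq₂, hr₁, hr₂, hv₁, hv₁', hv₂, hv₂', hR₁, hR₂⟩
    obtain ⟨c₁, c₂, c₃⟩ := sum_mem_of_mem_macRegion hr₁
    obtain ⟨d₁, d₂, d₃⟩ := sum_mem_of_mem_macRegion hr₂
    simp only [← Finset.mul_sum, hq₁, hq₂] at c₁ c₂ c₃ d₁ d₂ d₃
    exact ⟨_, _, v₁, v₂, ⟨Finset.sum_nonneg fun i _ => hr₁.1 _, Finset.sum_nonneg fun i _ => hr₁.1 _,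
      c₁, c₂, c₃, d₁, d₂, d₃, hv₁, hv₁', hv₂, hv₂'⟩, hR₁, hR₂⟩
  · rintro ⟨x, y, v₁, v₂, ⟨hx, hy, c₁, c₂, c₃, d₁, d₂, d₃, hv₁, hv₁', hv₂, hv₂'⟩, hR₁, hR₂⟩
    exact ⟨1, 1, fun _ => A.pub₁, fun _ => A.pub₂, _, v₁, v₂, fun _ => h₁, fun _ => h₂,
      by simp, by simp, mem_macRegion_of_single hx hy c₁ c₂ c₃,
      mem_macRegion_of_single hx hy d₁ d₂ d₃, hv₁, hv₁', hv₂, hv₂', by simpa using hR₁,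
      by simpa using hR₂⟩

/-- Used with `x` the public rate to be raised and `z` the public sum rate, each bounded at both
receivers. -/
lemma exists_pos_add_le {x z A B C D : ℝ} (hA : x < A) (hB : x < B) (hC : z < C) (hD : z < D) :
    ∃ ε > 0, x + ε ≤ A ∧ x + ε ≤ B ∧ z + ε ≤ C ∧ z + ε ≤ D := by
  refine ⟨min (min (A - x) (B - x)) (min (C - z) (D - z)), by simp [*], ?_⟩
  have h₁ := min_le_left (min (A - x) (B - x)) (min (C - z) (D - z))
  have h₂ := min_le_right (min (A - x) (B - x)) (min (C - z) (D - z))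
  rw [le_min_iff] at h₁ h₂
  refine ⟨?_, ?_, ?_, ?_⟩ <;> linarith [h₁.1, h₁.2, h₂.1, h₂.2]

/-- More public power of user 1 strictly relaxes every constraint on its public rate. -/
lemma SingleLayer.exists_increase₁ {a b : ℝ} (ha : 0 < a) (hb : 0 < b) {A : PowerAllocation}
    {P₁ P₂ x y v₁ v₂ : ℝ} (hA : A.Feasible P₁ P₂) (h : SingleLayer a b A x y v₁ v₂) {p : ℝ}
    (hp : A.pub₁ < p) : ∃ ε > 0, SingleLayer a b { A with pub₁ := p } (x + ε) y v₁ v₂ := by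
  obtain ⟨hp₁, hw₁, hp₂, hw₂, -, -⟩ := hA
  obtain ⟨hx, hy, c₁, c₂, c₃, d₁, d₂, d₃, hv⟩ := h
  have hs : 0 < A.priv₁ + a * A.priv₂ + 1 := by positivity
  have ht : 0 < b * A.priv₁ + A.priv₂ + 1 := by positivity
  have hbp : b * A.pub₁ < b * p := by gcongr
  obtain ⟨ε, hε, e₁, e₂, e₃, e₄⟩ := exists_pos_add_le
    (c₁.trans_lt (rate_div_lt_rate_div hp₁ hs hp))
    (d₁.trans_lt (rate_div_lt_rate_div (by positivity) ht hbp))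
    (c₃.trans_lt (rate_div_lt_rate_div (by positivity) hs (add_lt_add_left hp (a * A.pub₂))))
    (d₃.trans_lt (rate_div_lt_rate_div (by positivity) ht (add_lt_add_left hbp A.pub₂)))
  exact ⟨ε, hε, by linarith, hy, e₁, c₂, by linarith, e₂, d₂, by linarith, hv⟩

/-- More public power of user 2 strictly relaxes every constraint on its public rate. -/
lemma SingleLayer.exists_increase₂ {a b : ℝ} (ha : 0 < a) (hb : 0 < b) {A : PowerAllocation}
    {P₁ P₂ x y v₁ v₂ : ℝ} (hA : A.Feasible P₁ P₂) (h : SingleLayer a b A x y v₁ v₂) {p : ℝ}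
    (hp : A.pub₂ < p) : ∃ ε > 0, SingleLayer a b { A with pub₂ := p } x (y + ε) v₁ v₂ := by
  obtain ⟨hp₁, hw₁, hp₂, hw₂, -, -⟩ := hA
  obtain ⟨hx, hy, c₁, c₂, c₃, d₁, d₂, d₃, hv⟩ := h
  have hs : 0 < A.priv₁ + a * A.priv₂ + 1 := by positivity
  have ht : 0 < b * A.priv₁ + A.priv₂ + 1 := by positivity
  have hap : a * A.pub₂ < a * p := by gcongr
  obtain ⟨ε, hε, e₁, e₂, e₃, e₄⟩ := exists_pos_add_le
    (c₂.trans_lt (rate_div_lt_rate_div (by positivity) hs hap))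
    (d₂.trans_lt (rate_div_lt_rate_div hp₂ ht hp))
    (c₃.trans_lt (rate_div_lt_rate_div (by positivity) hs (add_lt_add_right hap A.pub₁)))
    (d₃.trans_lt (rate_div_lt_rate_div (by positivity) ht (add_lt_add_right hp (b * A.pub₁))))
  exact ⟨ε, hε, hx, by linarith, c₁, e₁, by linarith, d₁, e₂, by linarith, hv⟩

lemma IsOptimal.pub_add_priv_eq {a b P₁ P₂ μ : ℝ} (ha : 0 < a) (hb : 0 < b) (hμ : 0 < μ)
    {A : PowerAllocation} (h : IsOptimal a b P₁ P₂ μ A) :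
    A.pub₁ + A.priv₁ = P₁ ∧ A.pub₂ + A.priv₂ = P₂ := by
  obtain ⟨hA, R₁, R₂, hR, hmax⟩ := h
  have ⟨hp₁, hw₁, hp₂, hw₂, hb₁, hb₂⟩ := hA
  obtain ⟨x, y, v₁, v₂, hS, rfl, rfl⟩ := (isAchievable_iff hp₁ hp₂).1 hR
  refine ⟨hb₁.antisymm (le_of_not_gt fun hlt => ?_), hb₂.antisymm (le_of_not_gt fun hlt => ?_)⟩
  -- All the slack of user 1 goes to its public part.
  · obtain ⟨ε, hε, hS'⟩ := hS.exists_increase₁ ha hb hA (lt_sub_iff_add_lt.2 hlt)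
    have hp : 0 ≤ P₁ - A.priv₁ := by linarith
    have := hmax { A with pub₁ := P₁ - A.priv₁ } _ _
      ⟨hp, hw₁, hp₂, hw₂, (sub_add_cancel _ _).le, hb₂⟩
      ((isAchievable_iff (by exact hp) (by exact hp₂)).2 ⟨_, _, _, _, hS', rfl, rfl⟩)
    linarith
  · obtain ⟨ε, hε, hS'⟩ := hS.exists_increase₂ ha hb hA (lt_sub_iff_add_lt.2 hlt)
    have hp : 0 ≤ P₂ - A.priv₂ := by linarith
    have := hmax { A with pub₂ := P₂ - A.priv₂ } _ _
      ⟨hp₁, hw₁, hp, hw₂, hb₁, (sub_add_cancel _ _).le⟩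
      ((isAchievable_iff (by exact hp₁) (by exact hp)).2 ⟨_, _, _, _, hS', rfl, rfl⟩)
    nlinarith [mul_pos hμ hε]

/-- The power allocation given by the first four coordinates of a vector. -/
def allocationOf (z : Fin 8 → ℝ) : PowerAllocation := ⟨z 0, z 1, z 2, z 3⟩

/-- The vectors of feasible powers and single-layer rates that they allow. -/
def feasibleSet (a b P₁ P₂ : ℝ) : Set (Fin 8 → ℝ) :=
  {z | (allocationOf z).Feasible P₁ P₂ ∧
    SingleLayer a b (allocationOf z) (z 4) (z 5) (z 6) (z 7)}

lemma feasibleSet_subset_Icc {a b : ℝ} (ha : 0 ≤ a) (hb : 0 ≤ b) (P₁ P₂ : ℝ) :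
    feasibleSet a b P₁ P₂ ⊆
      Set.Icc 0 ![P₁, P₁, P₂, P₂, rate P₁, rate P₂, rate P₁, rate P₂] := by
  rintro z ⟨⟨hp₁, hw₁, hp₂, hw₂, hb₁, hb₂⟩,
    ⟨hx, hy, c₁, c₂, c₃, d₁, d₂, d₃, hv₁, hv₁', hv₂, hv₂'⟩⟩
  have haw := mul_nonneg ha hw₂
  have hbw := mul_nonneg hb hw₁
  -- Each public rate is bounded at its own receiver, where the gain is 1 and the noise at least 1.
  have e₄ := c₁.trans (rate_div_le_rate (P := P₁) hp₁ (by linarith) (by linarith))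
  have e₅ := d₂.trans (rate_div_le_rate (P := P₂) hp₂ (by linarith) (by linarith))
  have e₆ := hv₁'.trans (rate_div_le_rate (P := P₁) hw₁ (by linarith) (by linarith))
  have e₇ := hv₂'.trans (rate_div_le_rate (P := P₂) hw₂ (by linarith) (by linarith))
  simp only [allocationOf] at *
  rw [Set.mem_Icc, Pi.le_def, Pi.le_def]
  constructor
  · intro i
    fin_cases i <;> assumption
  · intro i
    fin_cases i
    · show z 0 ≤ P₁; linarith
    · show z 1 ≤ P₁; linarith
    · show z 2 ≤ P₂; linarith
    · show z 3 ≤ P₂; linarith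
    · exact e₄
    · exact e₅
    · exact e₆
    · exact e₇

lemma isClosed_feasibleSet {a b : ℝ} (ha : 0 ≤ a) (hb : 0 ≤ b) (P₁ P₂ : ℝ) :
    IsClosed (feasibleSet a b P₁ P₂) := by
  let F : Set (Fin 8 → ℝ) := {z | (allocationOf z).Feasible P₁ P₂}
  have hF : IsClosed F := by
    simp only [F, PowerAllocation.Feasible, allocationOf, Set.ofPred_and]
    repeat' apply IsClosed.inter
    all_goals exact isClosed_le (by fun_prop) (by fun_prop)
  -- The rate bounds are continuous only where the denominators stay positive, so closedness is
  -- proved inside the closed set `F`.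
  have key : ∀ f g h : (Fin 8 → ℝ) → ℝ, Continuous f → Continuous g → Continuous h →
      (∀ z, 0 ≤ z 0 → 0 ≤ z 1 → 0 ≤ z 2 → 0 ≤ z 3 → 0 ≤ f z) →
      (∀ z, 0 ≤ z 0 → 0 ≤ z 1 → 0 ≤ z 2 → 0 ≤ z 3 → 0 < g z) →
      IsClosed {z ∈ F | h z ≤ rate (f z / g z)} := fun f g h hf hg hh hf0 hg0 =>
    hF.isClosed_le hh.continuousOn (continuousOn_rate_div hf hg
      (fun z hz => hf0 z hz.1 hz.2.1 hz.2.2.1 hz.2.2.2.1)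
      (fun z hz => hg0 z hz.1 hz.2.1 hz.2.2.1 hz.2.2.2.1))
  have hset : feasibleSet a b P₁ P₂ =
      {z | 0 ≤ z 4} ∩ {z | 0 ≤ z 5} ∩
      {z ∈ F | z 4 ≤ rate (z 0 / (z 1 + a * z 3 + 1))} ∩
      {z ∈ F | z 5 ≤ rate ((a * z 2) / (z 1 + a * z 3 + 1))} ∩
      {z ∈ F | z 4 + z 5 ≤ rate ((z 0 + a * z 2) / (z 1 + a * z 3 + 1))} ∩
      {z ∈ F | z 4 ≤ rate ((b * z 0) / (b * z 1 + z 3 + 1))} ∩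
      {z ∈ F | z 5 ≤ rate (z 2 / (b * z 1 + z 3 + 1))} ∩
      {z ∈ F | z 4 + z 5 ≤ rate ((b * z 0 + z 2) / (b * z 1 + z 3 + 1))} ∩
      {z | 0 ≤ z 6} ∩ {z ∈ F | z 6 ≤ rate (z 1 / (a * z 3 + 1))} ∩
      {z | 0 ≤ z 7} ∩ {z ∈ F | z 7 ≤ rate (z 3 / (b * z 1 + 1))} := by
    ext z
    simp only [feasibleSet, SingleLayer, allocationOf, F, Set.mem_inter_iff, Set.mem_ofPred_eq]
    tauto
  rw [hset]
  -- Reducible transparency keeps the sets `{z ∈ F | _}` from being split as intersections.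
  repeat' with_reducible apply IsClosed.inter
  all_goals first
    | exact isClosed_le (by fun_prop) (by fun_prop)
    | exact key _ _ _ (by fun_prop) (by fun_prop) (by fun_prop)
        (by intros; positivity) (by intros; positivity)

lemma feasibleSet_nonempty {a b P₁ P₂ : ℝ} (hP₁ : 0 ≤ P₁) (hP₂ : 0 ≤ P₂) :
    (feasibleSet a b P₁ P₂).Nonempty :=
  ⟨0, by simp [feasibleSet, allocationOf, PowerAllocation.Feasible, SingleLayer, rate_zero, *]⟩

lemma exists_isOptimal {a b P₁ P₂ : ℝ} (ha : 0 ≤ a) (hb : 0 ≤ b) (hP₁ : 0 ≤ P₁) (hP₂ : 0 ≤ P₂)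
    (μ : ℝ) : ∃ A, IsOptimal a b P₁ P₂ μ A := by
  obtain ⟨z, hz, hmax⟩ := (isCompact_Icc.of_isClosed_subset (isClosed_feasibleSet ha hb P₁ P₂)
    (feasibleSet_subset_Icc ha hb P₁ P₂)).exists_isMaxOn (feasibleSet_nonempty hP₁ hP₂)
    (f := fun z => (z 4 + z 6) + μ * (z 5 + z 7)) (by fun_prop)
  refine ⟨allocationOf z, hz.1, z 4 + z 6, z 5 + z 7,
    (isAchievable_iff hz.1.1 hz.1.2.2.1).2 ⟨_, _, _, _, hz.2, rfl, rfl⟩, ?_⟩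
  intro A' R₁' R₂' hA' hR'
  obtain ⟨x, y, v₁, v₂, hS, rfl, rfl⟩ := (isAchievable_iff hA'.1 hA'.2.2.1).1 hR'
  exact hmax (a := ![A'.pub₁, A'.priv₁, A'.pub₂, A'.priv₂, x, y, v₁, v₂]) ⟨hA', hS⟩

end GIC

theorem theorem1 (a b P₁ P₂ μ : ℝ) (ha : 0 < a) (ha1 : a < 1) (hb : 0 < b) (hb1 : b < 1)
    (hP₁ : 0 ≤ P₁) (hP₂ : 0 ≤ P₂) (hμ : 0 < μ) :
    (∃ A : GIC.PowerAllocation, GIC.IsOptimal a b P₁ P₂ μ A) ∧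
    ∀ A : GIC.PowerAllocation, GIC.IsOptimal a b P₁ P₂ μ A →
      A.pub₁ + A.priv₁ = P₁ ∧ A.pub₂ + A.priv₂ = P₂ :=
  ⟨GIC.exists_isOptimal ha.le hb.le hP₁ hP₂ μ, fun _ hA => hA.pub_add_priv_eq ha hb hμ⟩
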